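/- For integers $M_1,M_2\ge 2$ let $T_{M_1,M_2}$ be the two-dimensional toroidal grid: the graph with vertex set $\mathbb{Z}_{M_1}\times\mathbb{Z}_{M_2}$ in which $x$ and $y$ are joined by an edge exactly when $x-y\in\{\pm(1,0),\pm(0,1)\}$. Regard a finite connected graph $G=(V,E)$ as an electrical network in which every edge has unit resistance. For $u,v\in V$, inject a unit current at $u$ and extract it at $v$; by Ohm's and Kirchhoff's laws this determines a potential $W:V\to\mathbb{R}$, unique up to an additive constant, with $\sum_{y:\{x,y\}\in E}(W_x-W_y)=\mathbf 1_{x=u}-\mathbf 1_{x=v}$ for all $x\in V$. The effective resistance is $R_{\rm eff}(u,v)=W_u-W_v$ (so $R_{\rm eff}(u,u)=0$), and the average effective resistance of $G$ is $$R_{\rm ave}(G)=\frac{1}{2|V|^2}\sum_{u,v\in V}R_{\rm eff}(u,v).$$ Suppose $4\le M_1\le M_2$. Then $$R_{\rm ave}(T_{M_1,M_2})\le \frac{1}{2\pi}\log M_2+\frac{1}{12}\frac{M_2}{M_1}+1$$ and $$R_{\rm ave}(T_{M_1,M_2})\ge \max\left\{\frac{1}{12}\frac{M_2}{M_1}-\frac{1}{24},\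 \frac{1}{2\pi}\log M_1-\frac{1}{12}\frac{M_2}{M_1}-\frac12\right\},$$ where $\log$ is the natural logarithm. -/

import Mathlib

/-- `W` is an electrical potential on the network `G`, all of whose edges have unit resistance,
when a unit current enters at `u` and leaves at `v`. By Ohm's law the current flowing from `x` to a
neighbor `y` is `W x - W y`; Kirchhoff's law says that the total current flowing out of `x` along
the edges equals the external current injected at `x`. -/
def IsUnitCurrentPotential {V : Type*} [Fintype V] (G : SimpleGraph V) (u v : V) (W : V → ℝ) :
    Prop :=
  open Classical in
  ∀ x : V, ∑ y ∈ G.neighborFinset x, (W x - W y) =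
    (if x = u then 1 else 0) - (if x = v then 1 else 0)

/-- Effective resistance between `u` and `v`: the potential difference `W u - W v`, for a potential
`W` of a unit current from `u` to `v`. On a connected graph such a `W` exists and is unique up to an
additive constant (`exists_isUnitCurrentPotential`, `IsUnitCurrentPotential.effectiveResistance_eq`
below); the value `0` is used when there is none. -/
noncomputable def effectiveResistance {V : Type*} [Fintype V] (G : SimpleGraph V) (u v : V) : ℝ :=
  open Classical in
  if h : ∃ W : V → ℝ, IsUnitCurrentPotential G u v W then h.choose u - h.choose v else 0

/-- Average effective resistance `(1 / (2 N²)) ∑_{u, v} R_eff(u, v)`, with `N = |V|`. -/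
noncomputable def averageResistance {V : Type*} [Fintype V] (G : SimpleGraph V) : ℝ :=
  1 / (2 * (Fintype.card V : ℝ) ^ 2) * ∑ u : V, ∑ v : V, effectiveResistance G u v

/-- The two-dimensional toroidal grid: vertex set `ℤ/M₁ × ℤ/M₂`, with `x` and `y` adjacent when
`x - y` is one of `±e₁`, `±e₂`. -/
def torusGrid (M₁ M₂ : ℕ) : SimpleGraph (ZMod M₁ × ZMod M₂) :=
  SimpleGraph.circulantGraph {(1, 0), (-1, 0), (0, 1), (0, -1)}

section WellDefined

variable {V : Type*} [Fintype V] {G : SimpleGraph V}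

open Classical in
theorem sum_neighbor_sub_eq_lapMatrix (W : V → ℝ) (x : V) :
    ∑ y ∈ G.neighborFinset x, (W x - W y) = (G.lapMatrix ℝ).mulVec W x := by
  rw [SimpleGraph.lapMatrix_mulVec_apply, Finset.sum_sub_distrib, Finset.sum_const,
    SimpleGraph.card_neighborFinset_eq_degree, nsmul_eq_mul]

open Classical in
theorem sum_lapMatrix_mulVec (W : V → ℝ) : ∑ x, (G.lapMatrix ℝ).mulVec W x = 0 := by
  have h : (1 : V → ℝ) ⬝ᵥ (G.lapMatrix ℝ).mulVec W = 0 := by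
    rw [Matrix.dotProduct_mulVec, ← Matrix.mulVec_transpose, (G.isSymm_lapMatrix (R := ℝ)).eq]
    have := G.lapMatrix_mulVec_const_eq_zero (R := ℝ)
    rw [show (1 : V → ℝ) = fun _ => 1 from rfl, this, zero_dotProduct]
  simpa [dotProduct] using h

theorem IsUnitCurrentPotential.effectiveResistance_eq (hG : G.Connected) {u v : V} {W : V → ℝ}
    (hW : IsUnitCurrentPotential G u v W) : effectiveResistance G u v = W u - W v := by
  classical
  have h : ∃ W : V → ℝ, IsUnitCurrentPotential G u v W := ⟨W, hW⟩
  rw [effectiveResistance, dif_pos h]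
  have hd : (G.lapMatrix ℝ).mulVec (h.choose - W) = 0 := by
    funext x
    have h1 := h.choose_spec x
    have h2 := hW x
    rw [← h2, sum_neighbor_sub_eq_lapMatrix, sum_neighbor_sub_eq_lapMatrix] at h1
    rw [Matrix.mulVec_sub, Pi.sub_apply, Pi.zero_apply, h1, sub_self]
  have := (G.lapMatrix_mulVec_eq_zero_iff_forall_reachable.1 hd) u v (hG.preconnected u v)
  simp only [Pi.sub_apply] at this
  linarith

theorem exists_isUnitCurrentPotential (hG : G.Connected) (u v : V) :
    ∃ W : V → ℝ, IsUnitCurrentPotential G u v W := by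
  classical
  have hN : (Fintype.card V : ℝ) ≠ 0 := by
    have : Nonempty V := ⟨u⟩
    exact_mod_cast Fintype.card_ne_zero
  let T : (V → ℝ) →ₗ[ℝ] (V → ℝ) :=
    { toFun := fun f x => (G.lapMatrix ℝ).mulVec f x + ∑ y, f y
      map_add' := fun f g => by
        funext x
        simp only [Matrix.mulVec_add, Pi.add_apply, Finset.sum_add_distrib]
        ring
      map_smul' := fun c f => by
        funext x
        simp only [Matrix.mulVec_smul, Pi.smul_apply, smul_eq_mul, RingHom.id_apply,
          ← Finset.mul_sum]
        ring }
  have hT : ∀ f x, T f x = (G.lapMatrix ℝ).mulVec f x + ∑ y, f y := fun _ _ => rfl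
  have hsum : ∀ f : V → ℝ, ∑ x, T f x = 0 → ∑ y, f y = 0 := by
    intro f hf
    simp only [hT, Finset.sum_add_distrib, sum_lapMatrix_mulVec, Finset.sum_const,
      Finset.card_univ, nsmul_eq_mul, zero_add] at hf
    exact (mul_eq_zero.1 hf).resolve_left hN
  have hinj : Function.Injective T := by
    rw [injective_iff_map_eq_zero]
    intro f hf
    have h0 := hsum f (by simp [hf])
    have hL : (G.lapMatrix ℝ).mulVec f = 0 := by
      funext x
      have := congrFun hf x
      rw [hT, h0, add_zero] at this
      exact this
    have hc := G.lapMatrix_mulVec_eq_zero_iff_forall_reachable.1 hL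
    funext x
    have : ∑ y, f y = Fintype.card V * f x := by
      rw [Finset.sum_congr rfl fun y _ => hc y x (hG.preconnected y x)]
      simp
    rw [h0] at this
    exact (mul_eq_zero.1 this.symm).resolve_left hN
  obtain ⟨W, hW⟩ := LinearMap.injective_iff_surjective.1 hinj
    (fun x => (if x = u then 1 else 0) - (if x = v then 1 else 0))
  have h0 := hsum W (by simp [hW])
  refine ⟨W, fun x => ?_⟩
  have := congrFun hW x
  rw [hT, h0, add_zero] at this
  rw [← this]
  convert sum_neighbor_sub_eq_lapMatrix W x

end WellDefined

theorem torusGrid_connected (M₁ M₂ : ℕ) [NeZero M₁] [NeZero M₂] :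
    (torusGrid M₁ M₂).Connected := by
  have step1 : ∀ p : ZMod M₁ × ZMod M₂, (torusGrid M₁ M₂).Reachable p (p.1 + 1, p.2) := by
    intro p
    by_cases h : p = (p.1 + 1, p.2)
    · rw [← h]
    · refine SimpleGraph.Adj.reachable ?_
      rw [torusGrid, SimpleGraph.circulantGraph, SimpleGraph.fromRel_adj]
      exact ⟨h, Or.inr (by simp [Prod.ext_iff])⟩
  have step2 : ∀ p : ZMod M₁ × ZMod M₂, (torusGrid M₁ M₂).Reachable p (p.1, p.2 + 1) := by
    intro p
    by_cases h : p = (p.1, p.2 + 1)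
    · rw [← h]
    · refine SimpleGraph.Adj.reachable ?_
      rw [torusGrid, SimpleGraph.circulantGraph, SimpleGraph.fromRel_adj]
      exact ⟨h, Or.inr (by simp [Prod.ext_iff])⟩
  have reach : ∀ m n : ℕ, (torusGrid M₁ M₂).Reachable (0, 0) ((m : ZMod M₁), (n : ZMod M₂)) := by
    intro m n
    induction m with
    | zero =>
      induction n with
      | zero => simp
      | succ n ih => exact ih.trans (by simpa using step2 _)
    | succ m ih => exact ih.trans (by simpa using step1 _)
  have reach' : ∀ p, (torusGrid M₁ M₂).Reachable (0, 0) p := fun p => by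
    simpa using reach p.1.val p.2.val
  exact ⟨fun p q => (reach' p).symm.trans (reach' q)⟩

/-! If `G` satisfies `LG = δ₀ - c` for the graph Laplacian `L`, then `G(x - u) - G(x - v)` is a unit
current potential, so by translation invariance the average resistance is `G 0` minus the mean of
`G`. Such a `G` is explicit. A Fourier series in the first coordinate turns mode `h` into the
operator `4 sin²(πh/M₁) - Δ` on the cycle of length `M₂`. With `sinh u = sin(πh/M₁)` its Green
function is a hyperbolic cosine; mode `0` gives a parabola. Only mode `0` contributes to the mean,
whence the exact formula `averageResistance_torusGrid`: `(M₂² - 1)/(12 M₁ M₂) + (1/M₁) ∑ₕ coth(M₂ u)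
/ (4 sinh u cosh u)`. With `s = sinh u`, each summand lies between `1/(4s) - 1/4` and `1/(4s) + 1/(4
M₂ s²)`. Comparing `1/sin` with its two poles gives `∑ 1/s = (2M₁/π) log M₁ + O(M₁)`, and `∑ 1/s² ≤
M₁²`, which yields the logarithm and the constants. -/

open Real Finset

/-! ### Reduction to a Green function. -/

theorem sum_neighborFinset_torusGrid {M₁ M₂ : ℕ} [NeZero M₁] [NeZero M₂] (h₁ : 3 ≤ M₁)
    (h₂ : 3 ≤ M₂) (p : ZMod M₁ × ZMod M₂) [Fintype ((torusGrid M₁ M₂).neighborSet p)]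
    (f : ZMod M₁ × ZMod M₂ → ℝ) :
    ∑ q ∈ (torusGrid M₁ M₂).neighborFinset p, f q =
      f (p + (1, 0)) + f (p - (1, 0)) + f (p + (0, 1)) + f (p - (0, 1)) := by
  classical
  -- For side lengths at least 3 the four steps are nonzero and distinct; for length 2, `e` and `-e`
  -- would coincide.
  have two_ne : ∀ {M : ℕ}, 3 ≤ M → (1 : ZMod M) ≠ 0 ∧ (1 : ZMod M) ≠ -1 := by
    intro M hM
    constructor
    · intro h
      have : ((1 : ℕ) : ZMod M) = 0 := by simpa using h
      rw [ZMod.natCast_eq_zero_iff] at this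
      exact absurd (Nat.le_of_dvd one_pos this) (by omega)
    · intro h
      have : ((2 : ℕ) : ZMod M) = 0 := by
        have : (1 : ZMod M) + 1 = 0 := by nth_rewrite 1 [h]; simp
        rw [← this]; norm_num
      rw [ZMod.natCast_eq_zero_iff] at this
      exact absurd (Nat.le_of_dvd two_pos this) (by omega)
  obtain ⟨a0, a1⟩ := two_ne h₁
  obtain ⟨b0, b1⟩ := two_ne h₂
  have a2 := neg_ne_zero.2 a0
  have b2 := neg_ne_zero.2 b0
  have hset : (torusGrid M₁ M₂).neighborFinset p =
      {p + (1, 0), p - (1, 0), p + (0, 1), p - (0, 1)} := by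
    ext q
    rw [SimpleGraph.mem_neighborFinset, torusGrid, SimpleGraph.circulantGraph,
      SimpleGraph.fromRel_adj]
    obtain ⟨d, rfl⟩ : ∃ d, q = p + d := ⟨q - p, by abel⟩
    have e1 : p - (p + d) = -d := by abel
    have e2 : p + d - p = d := by abel
    obtain ⟨d1, d2⟩ := d
    rw [e1, e2]
    simp only [sub_eq_add_neg, Set.mem_insert_iff, Set.mem_singleton_iff, mem_insert,
      mem_singleton, add_right_inj, Prod.neg_mk, Prod.mk.injEq, ne_eq,
      left_eq_add, Prod.mk_eq_zero, neg_zero, neg_eq_iff_eq_neg]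
    constructor
    · rintro ⟨-, h⟩
      grind
    · intro h
      refine ⟨?_, by grind⟩
      rintro ⟨rfl, rfl⟩
      simp [a0.symm, a2.symm, b0.symm, b2.symm] at h
  rw [hset, sum_insert, sum_insert, sum_insert, sum_singleton]
  · ring
  all_goals
    simp only [sub_eq_add_neg, mem_insert, mem_singleton, add_right_inj, Prod.neg_mk, neg_zero,
      Prod.mk.injEq]
    simp [a0, a1, a2, b0.symm, b1, b2.symm]

/-- If `G` is a fundamental solution of the Laplacian of the torus up to an additive constant, the
average resistance is the value of `G` at the origin minus its mean. -/
theorem averageResistance_torusGrid_eq {M₁ M₂ : ℕ} [NeZero M₁] [NeZero M₂] (h₁ : 3 ≤ M₁)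
    (h₂ : 3 ≤ M₂) (G : ZMod M₁ × ZMod M₂ → ℝ) (c : ℝ)
    (hG : ∀ p, 4 * G p - (G (p + (1, 0)) + G (p - (1, 0)) + G (p + (0, 1)) + G (p - (0, 1))) =
      (if p = 0 then 1 else 0) - c) :
    averageResistance (torusGrid M₁ M₂) = G 0 - (∑ p, G p) / (M₁ * M₂) := by
  classical
  have hR : ∀ u v, effectiveResistance (torusGrid M₁ M₂) u v =
      2 * G 0 - G (u - v) - G (v - u) := by
    intro u v
    have hW : IsUnitCurrentPotential (torusGrid M₁ M₂) u v (fun x => G (x - u) - G (x - v)) := by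
      intro x
      rw [sum_neighborFinset_torusGrid h₁ h₂]
      have e1 := hG (x - u)
      have e2 := hG (x - v)
      simp only [sub_eq_zero] at e1 e2
      have a1 : ∀ w d : ZMod M₁ × ZMod M₂, x + d - w = x - w + d := fun w d => by abel
      have a2 : ∀ w d : ZMod M₁ × ZMod M₂, x - d - w = x - w - d := fun w d => by abel
      simp only [a1, a2]
      -- The constant `c` cancels in the difference of the two translates.
      split_ifs at e1 e2 ⊢ <;> linarith
    rw [hW.effectiveResistance_eq (torusGrid_connected M₁ M₂)]
    simp only [sub_self]
    ring
  have hN : (M₁ : ℝ) * M₂ ≠ 0 := mul_ne_zero (NeZero.ne _) (NeZero.ne _)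
  have s1 : ∀ u, ∑ v, G (u - v) = ∑ p, G p := fun u =>
    Fintype.sum_equiv (Equiv.subLeft u) _ _ fun _ => rfl
  have s2 : ∀ u, ∑ v, G (v - u) = ∑ p, G p := fun u =>
    Fintype.sum_equiv (Equiv.subRight u) _ _ fun _ => rfl
  simp only [averageResistance, hR, sum_sub_distrib, s1, s2, sum_const, card_univ,
    Fintype.card_prod, ZMod.card, nsmul_eq_mul, Nat.cast_mul]
  field_simp
  ring

/-! ### Functions of representatives in `ℤ/M`. -/

theorem sum_zmod_val {M : ℕ} [NeZero M] (f : ℕ → ℝ) :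
    ∑ x : ZMod M, f x.val = ∑ k ∈ range M, f k := by
  refine sum_bij (fun x _ => x.val) (fun x _ => by simpa using ZMod.val_lt x)
    (fun x _ y _ h => ZMod.val_injective M h)
    (fun k hk => ⟨(k : ZMod M), by simp, ZMod.val_cast_of_lt (by simpa using hk)⟩)
    (fun _ _ => rfl)

theorem apply_val_add_one {M : ℕ} [NeZero M] (hM : 2 ≤ M) {f : ℝ → ℝ} (hf : f M = f 0)
    (x : ZMod M) : f ((x + 1).val) = f (x.val + 1) := by
  have : Fact (1 < M) := ⟨hM⟩
  have hx := ZMod.val_lt x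
  rw [ZMod.val_add, ZMod.val_one]
  rcases eq_or_lt_of_le (Nat.succ_le_of_lt hx) with h | h
  · have h' : x.val + 1 = M := h
    have h'' : (x.val : ℝ) + 1 = M := by exact_mod_cast h'
    rw [h', h'', Nat.mod_self, Nat.cast_zero, hf]
  · rw [Nat.mod_eq_of_lt h]; push_cast; rfl

/-- The wrap at `0` stays explicit because the cycle Green functions are symmetric under `y ↦ M - y`
but not periodic on `ℝ`. -/
theorem apply_val_sub_one {M : ℕ} [NeZero M] (hM : 2 ≤ M) (f : ℝ → ℝ) (x : ZMod M) :
    f ((x - 1).val) = if x = 0 then f (M - 1) else f (x.val - 1) := by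
  have : Fact (1 < M) := ⟨hM⟩
  split_ifs with h
  · subst h
    obtain ⟨n, rfl⟩ : ∃ n, M = n + 1 := ⟨M - 1, by omega⟩
    rw [zero_sub, ZMod.val_neg_one]
    simp
  · have h1 : 1 ≤ x.val := Nat.one_le_iff_ne_zero.2 (by simpa using h)
    rw [ZMod.val_sub (by rwa [ZMod.val_one]), ZMod.val_one, Nat.cast_sub h1, Nat.cast_one]

theorem sum_range_cos_two_pi_mul_div {M v : ℕ} (hv0 : v ≠ 0) (hv : v < M) :
    ∑ h ∈ range M, cos (2 * π * h * v / M) = 0 := by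
  have hM : M ≠ 0 := by omega
  have hM' : (M : ℂ) ≠ 0 := by exact_mod_cast hM
  have hζ := (Complex.isPrimitiveRoot_exp M hM)
  set ζ := Complex.exp (2 * π * Complex.I / M) with hζdef
  have h1 : ζ ^ v ≠ 1 := hζ.pow_ne_one_of_pos_of_lt hv0 hv
  have h2 : ∑ h ∈ range M, (ζ ^ v) ^ h = 0 := by
    have := mul_geom_sum (ζ ^ v) M
    rw [← pow_mul, mul_comm v, pow_mul, hζ.pow_eq_one, one_pow, sub_self] at this
    exact (mul_eq_zero.1 this).resolve_left (sub_ne_zero.2 h1)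
  have h3 := congrArg Complex.re h2
  rw [Complex.re_sum, Complex.zero_re] at h3
  rw [← h3]
  refine sum_congr rfl fun h _ => ?_
  rw [hζdef, ← Complex.exp_nat_mul, ← Complex.exp_nat_mul, ← Complex.exp_ofReal_mul_I_re]
  congr 2
  push_cast
  field_simp

/-! ### Green functions of the cycle. -/

/-- The Green function of the operator `4 sinh² u - Δ` on the cycle of length `M`, as a function
of a real position in `[0, M]`. -/
noncomputable def cycleGreen (M : ℕ) (u y : ℝ) : ℝ :=
  cosh (u * (M - 2 * y)) / (2 * sinh (2 * u) * sinh (M * u))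

/-- The Green function of `-Δ` on the cycle of length `M`, normalized to vanish at `0`. -/
noncomputable def cycleGreenZero (M : ℕ) (y : ℝ) : ℝ := -(y * (M - y)) / (2 * M)

/-- A unit step in `y` shifts the argument of `cosh` by `2u`, and `4 sinh² u + 2 = 2 cosh 2u`, so
the equation is the addition formula away from `0`. At `0` both neighbors carry `cosh(Mu - 2u)`,
leaving the defect `2 sinh 2u sinh Mu`, which is the normalizing denominator. -/
theorem cycleGreen_eq {M : ℕ} [NeZero M] (hM : 2 ≤ M) {u : ℝ} (hu : 0 < u) (x : ZMod M) :
    (4 * sinh u ^ 2 + 2) * cycleGreen M u x.val - cycleGreen M u (x + 1).val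
      - cycleGreen M u (x - 1).val = if x = 0 then 1 else 0 := by
  have hM0 : (0 : ℝ) < M := by exact_mod_cast (by omega : 0 < M)
  have h1 : sinh (2 * u) ≠ 0 := (sinh_pos_iff.2 (by positivity)).ne'
  have h2 : sinh (M * u) ≠ 0 := (sinh_pos_iff.2 (by positivity)).ne'
  have hc : 4 * sinh u ^ 2 + 2 = 2 * cosh (2 * u) := by
    rw [cosh_two_mul, cosh_sq]; ring
  rw [apply_val_add_one hM (f := cycleGreen M u), apply_val_sub_one hM (cycleGreen M u), hc]
  · split_ifs with h
    · subst h
      simp only [cycleGreen, ZMod.val_zero, Nat.cast_zero]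
      have e1 : u * ((M : ℝ) - 2 * (0 + 1)) = M * u - 2 * u := by ring
      have e2 : u * ((M : ℝ) - 2 * (M - 1)) = -(M * u - 2 * u) := by ring
      have e3 : u * ((M : ℝ) - 2 * 0) = M * u := by ring
      rw [e1, e2, e3, cosh_neg, cosh_sub]
      field_simp
      ring
    · simp only [cycleGreen]
      have e1 : u * ((M : ℝ) - 2 * (x.val + 1)) = u * (M - 2 * x.val) - 2 * u := by ring
      have e2 : u * ((M : ℝ) - 2 * (x.val - 1)) = u * (M - 2 * x.val) + 2 * u := by ring
      rw [e1, e2, cosh_sub, cosh_add]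
      field_simp
      ring
  · simp only [cycleGreen]
    rw [← cosh_neg]
    congr 2
    ring

theorem cycleGreenZero_eq {M : ℕ} [NeZero M] (hM : 2 ≤ M) (x : ZMod M) :
    2 * cycleGreenZero M x.val - cycleGreenZero M (x + 1).val - cycleGreenZero M (x - 1).val =
      (if x = 0 then 1 else 0) - 1 / M := by
  have hM0 : (M : ℝ) ≠ 0 := NeZero.ne _
  rw [apply_val_add_one hM (f := cycleGreenZero M) (by simp [cycleGreenZero]),
    apply_val_sub_one hM (cycleGreenZero M)]
  split_ifs with h
  · subst h
    simp only [cycleGreenZero, ZMod.val_zero, Nat.cast_zero]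
    field_simp
    ring
  · simp only [cycleGreenZero]
    field_simp
    ring

theorem sum_range_mul_sub (M : ℕ) (a : ℝ) :
    ∑ k ∈ range M, (k : ℝ) * (a - k) =
      a * (M * (M - 1)) / 2 - M * (M - 1) * (2 * M - 1) / 6 := by
  induction M with
  | zero => simp
  | succ n ih => rw [sum_range_succ, ih]; push_cast; ring

theorem cos_val_add_one_add_cos_val_sub_one {M : ℕ} [NeZero M] (hM : 2 ≤ M) (h : ℕ)
    (x : ZMod M) :
    cos (2 * π * h * (x + 1).val / M) + cos (2 * π * h * (x - 1).val / M) =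
      (2 - 4 * sin (π * h / M) ^ 2) * cos (2 * π * h * x.val / M) := by
  have hM0 : (M : ℝ) ≠ 0 := NeZero.ne _
  have per : ∀ z : ℝ, cos (2 * π * h * (z + M) / M) = cos (2 * π * h * z / M) := by
    intro z
    rw [show 2 * π * h * (z + M) / M = 2 * π * h * z / M + h * (2 * π) by field_simp]
    exact cos_add_nat_mul_two_pi _ _
  have e1 := apply_val_add_one hM (f := fun z => cos (2 * π * h * z / M))
    (by simpa using per 0) x
  have e2 : cos (2 * π * h * (x - 1).val / M) = cos (2 * π * h * (x.val - 1) / M) := by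
    have := apply_val_sub_one hM (fun z => cos (2 * π * h * z / M)) x
    rw [this]
    split_ifs with hx
    · subst hx
      rw [← per (((0 : ZMod M).val : ℝ) - 1)]
      simp only [ZMod.val_zero, Nat.cast_zero]
      congr 2
      ring
    · rfl
  rw [e1, e2]
  have a1 : 2 * π * h * ((x.val : ℝ) + 1) / M =
      2 * π * h * x.val / M + 2 * (π * h / M) := by ring
  have a2 : 2 * π * h * ((x.val : ℝ) - 1) / M =
      2 * π * h * x.val / M - 2 * (π * h / M) := by ring
  rw [a1, a2, cos_add, cos_sub, cos_two_mul]
  have := sin_sq_add_cos_sq (π * h / M)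
  linear_combination 4 * cos (2 * π * h * x.val / M) * this

/-! ### Green function of the torus and the exact formula. -/

/-- The Green function of the torus: Fourier series in the first coordinate, Green functions of the
cycle in the second. -/
noncomputable def torusGreen (M₁ M₂ : ℕ) (p : ZMod M₁ × ZMod M₂) : ℝ :=
  (cycleGreenZero M₂ p.2.val + ∑ h ∈ Ico 1 M₁, cos (2 * π * h * p.1.val / M₁) *
    cycleGreen M₂ (arsinh (sin (π * h / M₁))) p.2.val) / M₁

theorem sin_pi_mul_div_pos {M h : ℕ} (hh : h ∈ Ico 1 M) : 0 < sin (π * h / M) := by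
  rw [mem_Ico] at hh
  have h1 : (0 : ℝ) < h := by exact_mod_cast hh.1
  have h2 : (h : ℝ) < M := by exact_mod_cast hh.2
  apply sin_pos_of_pos_of_lt_pi
  · have := pi_pos
    have : (0 : ℝ) < M := h1.trans h2
    positivity
  · rw [div_lt_iff₀ (h1.trans h2)]
    exact mul_lt_mul_of_pos_left h2 pi_pos

theorem one_add_sum_Ico_cos {M : ℕ} [NeZero M] (x : ZMod M) :
    1 + ∑ h ∈ Ico 1 M, cos (2 * π * h * x.val / M) = if x = 0 then (M : ℝ) else 0 := by
  have h0 : 1 + ∑ h ∈ Ico 1 M, cos (2 * π * h * x.val / M) =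
      ∑ h ∈ range M, cos (2 * π * h * x.val / M) := by
    rw [range_eq_Ico, sum_eq_sum_Ico_succ_bot (Nat.pos_of_ne_zero (NeZero.ne M))]
    simp
  rw [h0]
  split_ifs with hx
  · subst hx; simp
  · exact sum_range_cos_two_pi_mul_div (by simpa using hx) (ZMod.val_lt x)

theorem torusGreen_eq {M₁ M₂ : ℕ} [NeZero M₁] [NeZero M₂] (h₁ : 2 ≤ M₁) (h₂ : 2 ≤ M₂)
    (p : ZMod M₁ × ZMod M₂) :
    4 * torusGreen M₁ M₂ p - (torusGreen M₁ M₂ (p + (1, 0)) + torusGreen M₁ M₂ (p - (1, 0)) +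
      torusGreen M₁ M₂ (p + (0, 1)) + torusGreen M₁ M₂ (p - (0, 1))) =
      (if p = 0 then 1 else 0) - 1 / (M₁ * M₂) := by
  obtain ⟨x, y⟩ := p
  have hM₁ : (M₁ : ℝ) ≠ 0 := NeZero.ne _
  simp only [torusGreen, Prod.mk_add_mk, Prod.mk_sub_mk, add_zero, sub_zero, ← sub_div, ← add_div,
    ← mul_div_assoc]
  rw [div_eq_iff hM₁]
  -- The cosine has eigenvalue `4 sin²(πh/M₁)`, exactly the mass term `4 sinh² u` in the second
  -- coordinate.
  have key : ∀ h ∈ Ico 1 M₁,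
      4 * (cos (2 * π * h * x.val / M₁) * cycleGreen M₂ (arsinh (sin (π * h / M₁))) y.val)
      - (cos (2 * π * h * (x + 1).val / M₁) * cycleGreen M₂ (arsinh (sin (π * h / M₁))) y.val
      + cos (2 * π * h * (x - 1).val / M₁) * cycleGreen M₂ (arsinh (sin (π * h / M₁))) y.val
      + cos (2 * π * h * x.val / M₁) * cycleGreen M₂ (arsinh (sin (π * h / M₁))) (y + 1).val
      + cos (2 * π * h * x.val / M₁) * cycleGreen M₂ (arsinh (sin (π * h / M₁))) (y - 1).val)
      = cos (2 * π * h * x.val / M₁) * (if y = 0 then 1 else 0) := by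
    intro h hh
    have e1 := cos_val_add_one_add_cos_val_sub_one h₁ h x
    have e2 := cycleGreen_eq h₂ (arsinh_pos_iff.2 (sin_pi_mul_div_pos hh)) y
    rw [sinh_arsinh] at e2
    rw [← e2]
    linear_combination (-cycleGreen M₂ (arsinh (sin (π * h / M₁))) y.val) * e1
  have key' := sum_congr rfl key
  rw [sum_sub_distrib, ← mul_sum, sum_add_distrib, sum_add_distrib, sum_add_distrib,
    ← sum_mul] at key'
  have e0 := cycleGreenZero_eq h₂ y
  have e3 := one_add_sum_Ico_cos x
  have e4 : (if ((x, y) : ZMod M₁ × ZMod M₂) = 0 then (1 : ℝ) else 0) * M₁ =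
      (if x = 0 then (M₁ : ℝ) else 0) * (if y = 0 then 1 else 0) := by
    simp only [Prod.mk_eq_zero]
    split_ifs <;> simp_all
  have e5 : 1 / ((M₁ : ℝ) * M₂) * M₁ = 1 / M₂ := by
    field_simp
  rw [sub_mul, e4, e5, ← e3]
  -- The `1` in `one_add_sum_Ico_cos` is the contribution of mode `0`.
  linear_combination e0 + key'

theorem sum_torusGreen {M₁ M₂ : ℕ} [NeZero M₁] [NeZero M₂] :
    ∑ p, torusGreen M₁ M₂ p = -((M₂ : ℝ) ^ 2 - 1) / 12 := by
  have hM₁ : (M₁ : ℝ) ≠ 0 := NeZero.ne _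
  have hM₂ : (M₂ : ℝ) ≠ 0 := NeZero.ne _
  have hz : ∑ y : ZMod M₂, cycleGreenZero M₂ y.val = -((M₂ : ℝ) ^ 2 - 1) / 12 := by
    rw [sum_zmod_val fun k => cycleGreenZero M₂ k]
    simp only [cycleGreenZero, ← sum_div, sum_neg_distrib, sum_range_mul_sub]
    field_simp
    ring
  have hx : ∀ y : ZMod M₂, ∑ x : ZMod M₁, torusGreen M₁ M₂ (x, y) = cycleGreenZero M₂ y.val := by
    intro y
    simp only [torusGreen, ← sum_div, sum_add_distrib, sum_const, card_univ, ZMod.card,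
      nsmul_eq_mul]
    rw [sum_comm, sum_eq_zero, add_zero, mul_div_cancel_left₀ _ hM₁]
    intro h hh
    rw [← sum_mul, sum_zmod_val fun k => cos (2 * π * h * k / M₁)]
    rw [mem_Ico] at hh
    have := sum_range_cos_two_pi_mul_div (M := M₁) (v := h) (by omega) hh.2
    rw [sum_congr rfl fun k _ => by rw [mul_right_comm], this, zero_mul]
  rw [Fintype.sum_prod_type_right, sum_congr rfl fun y _ => hx y, hz]

theorem averageResistance_torusGrid {M₁ M₂ : ℕ} [NeZero M₁] [NeZero M₂] (h₁ : 3 ≤ M₁)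
    (h₂ : 3 ≤ M₂) :
    averageResistance (torusGrid M₁ M₂) = ((M₂ : ℝ) ^ 2 - 1) / (12 * M₁ * M₂) +
      (∑ h ∈ Ico 1 M₁, cycleGreen M₂ (arsinh (sin (π * h / M₁))) 0) / M₁ := by
  have hM₁ : (M₁ : ℝ) ≠ 0 := NeZero.ne _
  have hM₂ : (M₂ : ℝ) ≠ 0 := NeZero.ne _
  rw [averageResistance_torusGrid_eq h₁ h₂ (torusGreen M₁ M₂) _
    (torusGreen_eq (by omega) (by omega)), sum_torusGreen]
  simp [torusGreen, cycleGreenZero]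
  field_simp
  ring

/-! ### Bounds for the cycle Green function at the origin. -/

theorem cycleGreen_zero_nonneg {M : ℕ} {s : ℝ} (hs : 0 ≤ s) : 0 ≤ cycleGreen M (arsinh s) 0 := by
  have hu := arsinh_nonneg_iff.2 hs
  have h1 : 0 ≤ sinh (2 * arsinh s) := sinh_nonneg_iff.2 (by positivity)
  have h2 : 0 ≤ sinh (M * arsinh s) := sinh_nonneg_iff.2 (by positivity)
  exact div_nonneg (cosh_pos _).le (by positivity)

/-- Uses `coth ≥ 1`, and `1 / cosh u ≥ 1 - s` from `cosh u ≤ 1 + s`. -/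
theorem le_cycleGreen_zero {M : ℕ} (hM : M ≠ 0) {s : ℝ} (hs : 0 < s) :
    1 / (4 * s) - 1 / 4 ≤ cycleGreen M (arsinh s) 0 := by
  have hu := arsinh_pos_iff.2 hs
  have hsu := sinh_arsinh s
  set u := arsinh s
  have hM0 : (0 : ℝ) < M := by exact_mod_cast Nat.pos_of_ne_zero hM
  have hS : 0 < sinh (M * u) := sinh_pos_iff.2 (by positivity)
  have hc := cosh_pos u
  have hc1 : cosh u ≤ 1 + s := by
    have := cosh_sq u
    rw [hsu] at this
    nlinarith
  rw [cycleGreen, sinh_two_mul, hsu, show u * ((M : ℝ) - 2 * 0) = M * u by ring]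
  calc 1 / (4 * s) - 1 / 4 ≤ 1 / (4 * s * cosh u) := by
        rw [div_sub_div _ _ (by positivity) (by norm_num), div_le_div_iff₀ (by positivity)
          (by positivity)]
        nlinarith [mul_pos hs hc, mul_nonneg hs.le (sub_nonneg.2 hc1), sq_nonneg s,
          mul_nonneg hs.le (mul_nonneg hs.le hc.le), one_le_cosh u]
    _ = sinh (M * u) / (2 * (2 * s * cosh u) * sinh (M * u)) := by field_simp; ring
    _ ≤ _ := by gcongr; exact (sinh_lt_cosh _).le

theorem sinh_le_mul_cosh {x : ℝ} (hx : 0 ≤ x) : sinh x ≤ x * cosh x := by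
  have hd : ∀ y, HasDerivAt (fun y => y * cosh y - sinh y) (y * sinh y) y := fun y => by
    have := ((hasDerivAt_id y).mul (hasDerivAt_cosh y)).sub (hasDerivAt_sinh y)
    refine this.congr_deriv ?_
    simp
  have hmono : MonotoneOn (fun y => y * cosh y - sinh y) (Set.Ici 0) := by
    refine monotoneOn_of_deriv_nonneg (convex_Ici 0)
      (fun y _ => (hd y).continuousAt.continuousWithinAt)
      (fun y _ => (hd y).differentiableAt.differentiableWithinAt) fun y hy => ?_
    rw [interior_Ici, Set.mem_Ioi] at hy
    rw [(hd y).deriv]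
    exact mul_nonneg hy.le (sinh_nonneg_iff.2 hy.le)
  have := hmono (Set.mem_Ici.2 le_rfl) (Set.mem_Ici.2 hx) hx
  simp only [sinh_zero, zero_mul, sub_zero] at this
  linarith

/-- `coth x - 1 = exp(-x) / sinh x`, and `2x ≤ exp(2x) - 1` bounds this by `1/x`. -/
theorem cosh_le_one_add_inv_mul_sinh {x : ℝ} (hx : 0 < x) :
    cosh x ≤ (1 + 1 / x) * sinh x := by
  have h1 : x * exp (-x) ≤ sinh x := by
    have := add_one_le_exp (2 * x)
    have h2 : exp x = exp (2 * x) * exp (-x) := by rw [← exp_add]; ring_nf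
    rw [sinh_eq, h2]
    nlinarith [exp_pos (-x)]
  have h3 := cosh_sub_sinh x
  have : exp (-x) ≤ 1 / x * sinh x := by
    rw [one_div, ← div_eq_inv_mul, le_div_iff₀ hx]; linarith
  linarith

theorem cycleGreen_zero_le {M : ℕ} (hM : M ≠ 0) {s : ℝ} (hs : 0 < s) :
    cycleGreen M (arsinh s) 0 ≤ 1 / (4 * s) + 1 / (4 * M * s ^ 2) := by
  have hu := arsinh_pos_iff.2 hs
  have hsu := sinh_arsinh s
  set u := arsinh s
  have hM0 : (0 : ℝ) < M := by exact_mod_cast Nat.pos_of_ne_zero hM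
  have hS : 0 < sinh (M * u) := sinh_pos_iff.2 (by positivity)
  have hc := cosh_pos u
  have h1 := one_le_cosh u
  have hsc := sinh_le_mul_cosh hu.le
  rw [hsu] at hsc
  rw [cycleGreen, sinh_two_mul, hsu, show u * ((M : ℝ) - 2 * 0) = M * u by ring]
  calc cosh (M * u) / (2 * (2 * s * cosh u) * sinh (M * u))
      ≤ ((1 + 1 / (M * u)) * sinh (M * u)) / (2 * (2 * s * cosh u) * sinh (M * u)) := by
        gcongr; exact cosh_le_one_add_inv_mul_sinh (by positivity)
    _ = 1 / (4 * s * cosh u) + 1 / (4 * M * (s * (u * cosh u))) := by field_simp; ring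
    -- `cosh u ≥ 1` in the main term; `u cosh u ≥ sinh u = s` in the error term.
    _ ≤ 1 / (4 * s * 1) + 1 / (4 * M * (s * s)) := by gcongr
    _ = _ := by rw [mul_one, sq]

/-! ### Comparison of `1/sin` with its poles at `0` and `1`. -/

theorem le_one_div_sin_pi_mul {x : ℝ} (hx : 0 < x) (hx1 : x < 1) :
    1 / (π * x) + 1 / (π * (1 - x)) - 2 / π ≤ 1 / sin (π * x) := by
  wlog h : x ≤ 1 / 2 generalizing x
  · have := this (x := 1 - x) (by linarith) (by linarith) (by linarith)
    rw [sub_sub_cancel, show π * (1 - x) = π - π * x by ring, sin_pi_sub] at this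
    rw [show π * (1 - x) = π - π * x by ring]
    linarith
  have hpi := pi_pos
  -- On `x ≤ 1/2` the far pole is at most the subtracted `2/π`.
  have h1 : 1 / (π * (1 - x)) ≤ 2 / π := by
    rw [div_le_div_iff₀ (mul_pos hpi (by linarith)) hpi]
    nlinarith
  have h2 : 1 / (π * x) ≤ 1 / sin (π * x) :=
    one_div_le_one_div_of_le (sin_pos_of_pos_of_lt_pi (by positivity) (by nlinarith))
      (sin_le (by positivity))
  linarith

theorem one_div_sin_pi_mul_le {x : ℝ} (hx : 0 < x) (hx1 : x < 1) :
    1 / sin (π * x) ≤ 1 / (π * x) + 1 / (π * (1 - x)) + 1 := by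
  wlog h : x ≤ 1 / 2 generalizing x
  · have := this (x := 1 - x) (by linarith) (by linarith) (by linarith)
    rw [sub_sub_cancel, show π * (1 - x) = π - π * x by ring, sin_pi_sub] at this
    rw [show π * (1 - x) = π - π * x by ring]
    linarith
  have hpi := pi_pos
  have hpi4 := pi_lt_four
  have h1 : 0 < 1 / (π * (1 - x)) := one_div_pos.2 (mul_pos hpi (by linarith))
  set y := π * x with hy
  have hy0 : 0 < y := by positivity
  have hs : 0 < sin y := sin_pos_of_pos_of_lt_pi hy0 (by nlinarith)
  -- Up to `y = 1`, `sin y > y - y³/4` suffices; beyond it, Jordan's inequality `sin y ≥ 2y/π`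
  -- together with `1 + y ≥ 2` and `π < 4`.
  have key : y ≤ sin y * (1 + y) := by
    rcases le_or_gt y 1 with h | h
    · have := sin_gt_sub_cube hy0
      have h3 : y ^ 3 ≤ y ^ 2 := pow_le_pow_of_le_one hy0.le h (by norm_num)
      have h4 : y ^ 4 ≤ y ^ 2 := pow_le_pow_of_le_one hy0.le h (by norm_num)
      nlinarith [sq_nonneg y]
    · have h5 := mul_le_sin hy0.le (by rw [hy]; nlinarith)
      have h6 : 2 / π * y * 2 ≤ sin y * (1 + y) := by
        apply mul_le_mul h5 (by linarith) (by norm_num) hs.le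
      have h7 : 1 ≤ 2 / π * 2 := by
        rw [div_mul_eq_mul_div, le_div_iff₀ hpi]; linarith
      nlinarith
  have : 1 / sin y ≤ 1 / y + 1 := by
    rw [div_add_one hy0.ne', div_le_div_iff₀ hs hy0]
    linarith
  linarith

theorem one_div_sin_pi_mul_sq_le {x : ℝ} (hx : 0 < x) (hx1 : x < 1) :
    1 / sin (π * x) ^ 2 ≤ 1 / (4 * x ^ 2) + 1 / (4 * (1 - x) ^ 2) := by
  wlog h : x ≤ 1 / 2 generalizing x
  · have := this (x := 1 - x) (by linarith) (by linarith) (by linarith)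
    rw [sub_sub_cancel, show π * (1 - x) = π - π * x by ring, sin_pi_sub] at this
    linarith
  have hpi := pi_pos
  have h5 := mul_le_sin (x := π * x) (by positivity) (by nlinarith)
  rw [show 2 / π * (π * x) = 2 * x by field_simp] at h5
  have h1 : 0 < 1 - x := by linarith
  have h6 : 1 / sin (π * x) ^ 2 ≤ 1 / (2 * x) ^ 2 := by gcongr
  have h7 : 0 ≤ 1 / (4 * (1 - x) ^ 2) := by positivity
  rw [mul_pow, show (2 : ℝ) ^ 2 = 4 by norm_num] at h6
  linarith

/-! ### Harmonic sums and sums of `1/sin`, `1/sin²`. -/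

theorem sum_Ico_one_div_eq_harmonic {M : ℕ} :
    ∑ h ∈ Ico 1 M, 1 / (h : ℝ) = harmonic (M - 1) := by
  rw [harmonic_eq_sum_Icc]
  push_cast
  rcases M with _ | n
  · simp
  · simp only [one_div, Nat.add_sub_cancel]
    rfl

theorem log_le_sum_Ico {M : ℕ} (hM : 1 ≤ M) : log M ≤ ∑ h ∈ Ico 1 M, 1 / (h : ℝ) := by
  rw [sum_Ico_one_div_eq_harmonic]
  have := log_add_one_le_harmonic (M - 1)
  rwa [Nat.sub_add_cancel hM] at this

theorem sum_Ico_le_one_add_log {M : ℕ} (hM : 2 ≤ M) :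
    ∑ h ∈ Ico 1 M, 1 / (h : ℝ) ≤ 1 + log M := by
  rw [sum_Ico_one_div_eq_harmonic]
  refine (harmonic_le_one_add_log (M - 1)).trans ?_
  have h1 : (0 : ℝ) < (M - 1 : ℕ) := by exact_mod_cast (by omega : 0 < M - 1)
  gcongr
  omega

theorem sum_Ico_one_div_sq_le (M : ℕ) : ∑ h ∈ Ico 1 M, 1 / (h : ℝ) ^ 2 ≤ 2 := by
  -- Telescoping, with the bound sharpened so that induction goes through.
  have key : ∀ n : ℕ, ∑ h ∈ Ico 1 (n + 2), 1 / (h : ℝ) ^ 2 ≤ 2 - 1 / ((n : ℝ) + 1) := by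
    intro n
    induction n with
    | zero => norm_num
    | succ n ih =>
      rw [sum_Ico_succ_top (by omega)]
      have : 1 / ((n + 1 + 1 : ℕ) : ℝ) ^ 2 ≤ 1 / ((n : ℝ) + 1) - 1 / ((n + 1 : ℕ) + 1) := by
        push_cast
        rw [div_sub_div _ _ (by positivity) (by positivity),
          div_le_div_iff₀ (by positivity) (by positivity)]
        nlinarith [(Nat.cast_nonneg n : (0 : ℝ) ≤ n)]
      linarith
  rcases le_or_gt M 1 with hM | hM
  · simp [Ico_eq_empty_of_le hM]
  · obtain ⟨n, rfl⟩ : ∃ n, M = n + 2 := ⟨M - 2, by omega⟩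
    have : (0 : ℝ) < 1 / (n + 1) := by positivity
    linarith [key n]

theorem sum_Ico_sub_eq (M : ℕ) (f : ℝ → ℝ) :
    ∑ h ∈ Ico 1 M, f (M - h) = ∑ h ∈ Ico 1 M, f h := by
  refine sum_bij' (fun h _ => M - h) (fun h _ => M - h) ?_ ?_ ?_ ?_ ?_
  all_goals
    intro h hh
    rw [mem_Ico] at hh
  · rw [mem_Ico]; omega
  · rw [mem_Ico]; omega
  · omega
  · omega
  · rw [Nat.cast_sub hh.2.le]

theorem div_mem_Ioo {M h : ℕ} (hh : h ∈ Ico 1 M) : 0 < (h : ℝ) / M ∧ (h : ℝ) / M < 1 := by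
  rw [mem_Ico] at hh
  have h1 : (0 : ℝ) < h := by exact_mod_cast hh.1
  have h2 : (h : ℝ) < M := by exact_mod_cast hh.2
  exact ⟨div_pos h1 (h1.trans h2), (div_lt_one (h1.trans h2)).2 h2⟩

theorem sum_Ico_one_div_mul_div {M : ℕ} (hM : M ≠ 0) :
    ∑ h ∈ Ico 1 M, (1 / (π * (h / M)) + 1 / (π * (1 - h / M))) =
      2 * M / π * ∑ h ∈ Ico 1 M, 1 / (h : ℝ) := by
  have hM0 : (M : ℝ) ≠ 0 := by exact_mod_cast hM
  have e1 : ∀ h : ℝ, 1 / (π * (h / M)) = M / π * (1 / h) := fun h => by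
    rw [one_div, mul_inv, inv_div]; ring
  have e2 : ∀ h : ℝ, 1 / (π * (1 - h / M)) = M / π * (1 / (M - h)) := fun h => by
    rw [← e1]; congr 2; field_simp
  simp only [e1, e2, sum_add_distrib, ← mul_sum]
  rw [sum_Ico_sub_eq M fun z => 1 / z]
  ring

theorem le_sum_one_div_sin {M : ℕ} (hM : 1 ≤ M) :
    2 * M / π * log M - 2 * M / π ≤ ∑ h ∈ Ico 1 M, 1 / sin (π * h / M) := by
  have hpi := pi_pos
  have h0 := sum_le_sum fun h (hh : h ∈ Ico 1 M) =>
    le_one_div_sin_pi_mul (div_mem_Ioo hh).1 (div_mem_Ioo hh).2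
  rw [sum_sub_distrib, sum_Ico_one_div_mul_div (by omega), sum_const, Nat.card_Ico,
    nsmul_eq_mul, Nat.cast_sub hM, Nat.cast_one] at h0
  simp only [← mul_div_assoc] at h0
  have h1 : 2 * M / π * log M ≤ 2 * M / π * ∑ h ∈ Ico 1 M, 1 / (h : ℝ) := by
    gcongr; exact log_le_sum_Ico hM
  have h2 : ((M : ℝ) - 1) * 2 / π ≤ 2 * M / π := by
    apply div_le_div_of_nonneg_right _ hpi.le
    linarith
  linarith

theorem sum_one_div_sin_le {M : ℕ} (hM : 2 ≤ M) :
    ∑ h ∈ Ico 1 M, 1 / sin (π * h / M) ≤ 2 * M / π * (1 + log M) + M := by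
  have hpi := pi_pos
  have h0 := sum_le_sum fun h (hh : h ∈ Ico 1 M) =>
    one_div_sin_pi_mul_le (div_mem_Ioo hh).1 (div_mem_Ioo hh).2
  rw [sum_add_distrib, sum_Ico_one_div_mul_div (by omega), sum_const, Nat.card_Ico,
    nsmul_eq_mul, Nat.cast_sub (by omega), Nat.cast_one] at h0
  simp only [← mul_div_assoc] at h0
  have h1 : 2 * M / π * ∑ h ∈ Ico 1 M, 1 / (h : ℝ) ≤ 2 * M / π * (1 + log M) := by
    gcongr; exact sum_Ico_le_one_add_log hM
  linarith

theorem sum_one_div_sin_sq_le {M : ℕ} (hM : M ≠ 0) :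
    ∑ h ∈ Ico 1 M, 1 / sin (π * h / M) ^ 2 ≤ (M : ℝ) ^ 2 := by
  have hM0 : (M : ℝ) ≠ 0 := by exact_mod_cast hM
  have h0 := sum_le_sum fun h (hh : h ∈ Ico 1 M) =>
    one_div_sin_pi_mul_sq_le (div_mem_Ioo hh).1 (div_mem_Ioo hh).2
  simp only [← mul_div_assoc] at h0
  refine h0.trans ?_
  have e1 : ∀ h : ℝ, 1 / (4 * (h / M) ^ 2) = (M : ℝ) ^ 2 / 4 * (1 / h ^ 2) := fun h => by
    rw [one_div, mul_inv, div_pow, inv_div]; ring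
  have e2 : ∀ h : ℝ, 1 / (4 * (1 - h / M) ^ 2) = (M : ℝ) ^ 2 / 4 * (1 / (M - h) ^ 2) :=
    fun h => by
      rw [← e1]; congr 3; field_simp
  simp only [e1, e2, sum_add_distrib, ← mul_sum]
  rw [sum_Ico_sub_eq M fun z => 1 / z ^ 2]
  have := mul_le_mul_of_nonneg_left (sum_Ico_one_div_sq_le M)
    (by positivity : (0 : ℝ) ≤ (M : ℝ) ^ 2 / 4)
  linarith

/-! ### Assembly of the bounds. -/

theorem sum_cycleGreen_le {M₁ M₂ : ℕ} (h₁ : 2 ≤ M₁) (h₂ : M₁ ≤ M₂) :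
    (∑ h ∈ Ico 1 M₁, cycleGreen M₂ (arsinh (sin (π * h / M₁))) 0) / M₁ ≤
      1 / (2 * π) * log M₁ + 1 / (2 * π) + 1 / 2 := by
  have hpi := pi_pos
  have hM₁ : (0 : ℝ) < M₁ := by exact_mod_cast (by omega : 0 < M₁)
  have hM : (M₁ : ℝ) ≤ M₂ := by exact_mod_cast h₂
  have hterm : ∀ h ∈ Ico 1 M₁, cycleGreen M₂ (arsinh (sin (π * h / M₁))) 0 ≤
      1 / 4 * (1 / sin (π * h / M₁)) + 1 / (4 * M₁) * (1 / sin (π * h / M₁) ^ 2) := by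
    intro h hh
    have hs := sin_pi_mul_div_pos hh
    refine (cycleGreen_zero_le (by omega) hs).trans ?_
    rw [one_div_mul_one_div, one_div_mul_one_div]
    -- Here `M₁ ≤ M₂` replaces `1/M₂` by `1/M₁`, so that the `1/sin²` sum costs only `1/4` after
    -- division by `M₁`.
    gcongr
  have hsum := sum_le_sum hterm
  rw [sum_add_distrib, ← mul_sum, ← mul_sum] at hsum
  have b1 := sum_one_div_sin_le h₁
  have b2 := sum_one_div_sin_sq_le (M := M₁) (by omega)
  have b3 : 1 / (4 * (M₁ : ℝ)) * ∑ h ∈ Ico 1 M₁, 1 / sin (π * h / M₁) ^ 2 ≤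
      1 / (4 * M₁) * (M₁ : ℝ) ^ 2 := by gcongr
  have e : 1 / (4 * (M₁ : ℝ)) * (M₁ : ℝ) ^ 2 = M₁ / 4 := by field_simp
  rw [div_le_iff₀ hM₁]
  have e2 : (1 / (2 * π) * log M₁ + 1 / (2 * π) + 1 / 2) * M₁ =
      1 / 4 * (2 * M₁ / π * (1 + log M₁) + M₁) + M₁ / 4 := by field_simp; ring
  linarith

theorem le_sum_cycleGreen {M₁ M₂ : ℕ} (h₁ : 1 ≤ M₁) (h₂ : M₂ ≠ 0) :
    1 / (2 * π) * log M₁ - 1 / (2 * π) - 1 / 4 ≤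
      (∑ h ∈ Ico 1 M₁, cycleGreen M₂ (arsinh (sin (π * h / M₁))) 0) / M₁ := by
  have hpi := pi_pos
  have hM₁ : (0 : ℝ) < M₁ := by exact_mod_cast (by omega : 0 < M₁)
  have hterm : ∀ h ∈ Ico 1 M₁, 1 / 4 * (1 / sin (π * h / M₁)) - 1 / 4 ≤
      cycleGreen M₂ (arsinh (sin (π * h / M₁))) 0 := by
    intro h hh
    rw [one_div_mul_one_div]
    exact le_cycleGreen_zero h₂ (sin_pi_mul_div_pos hh)
  have hsum := sum_le_sum hterm
  rw [sum_sub_distrib, ← mul_sum, sum_const, Nat.card_Ico, nsmul_eq_mul, Nat.cast_sub h₁,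
    Nat.cast_one] at hsum
  have b1 := le_sum_one_div_sin h₁
  rw [le_div_iff₀ hM₁]
  have e2 : (1 / (2 * π) * log M₁ - 1 / (2 * π) - 1 / 4) * M₁ =
      1 / 4 * (2 * M₁ / π * log M₁ - 2 * M₁ / π) - M₁ / 4 := by field_simp; ring
  linarith

theorem theorem2 (M₁ M₂ : ℕ) [NeZero M₁] [NeZero M₂] (h₁ : 4 ≤ M₁) (h₂ : M₁ ≤ M₂) :
    averageResistance (torusGrid M₁ M₂) ≤
        1 / (2 * Real.pi) * Real.log M₂ + 1 / 12 * ((M₂ : ℝ) / M₁) + 1 ∧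
      averageResistance (torusGrid M₁ M₂) ≥
        max (1 / 12 * ((M₂ : ℝ) / M₁) - 1 / 24)
          (1 / (2 * Real.pi) * Real.log M₁ - 1 / 12 * ((M₂ : ℝ) / M₁) - 1 / 2) := by
  have hpi := pi_gt_three
  have hM₁ : (4 : ℝ) ≤ M₁ := by exact_mod_cast h₁
  have hM : (M₁ : ℝ) ≤ M₂ := by exact_mod_cast h₂
  have hM₁0 : (0 : ℝ) < M₁ := by linarith
  have hM₂0 : (0 : ℝ) < M₂ := by linarith
  have hπ : 1 / (2 * π) ≤ 1 / 4 := by gcongr; linarith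
  have e : ((M₂ : ℝ) ^ 2 - 1) / (12 * M₁ * M₂) =
      1 / 12 * ((M₂ : ℝ) / M₁) - 1 / (12 * M₁ * M₂) := by field_simp
  have hr : 1 / (12 * M₁ * M₂ : ℝ) ≤ 1 / 24 := by
    gcongr; nlinarith
  have hr0 : 0 < 1 / (12 * M₁ * M₂ : ℝ) := by positivity
  have hq : 1 ≤ (M₂ : ℝ) / M₁ := (one_le_div hM₁0).2 hM
  rw [averageResistance_torusGrid (by omega) (by omega), e]
  have hup := sum_cycleGreen_le (by omega) h₂
  have hlo := le_sum_cycleGreen (M₁ := M₁) (M₂ := M₂) (by omega) (by omega)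
  have hpos : 0 ≤ (∑ h ∈ Ico 1 M₁, cycleGreen M₂ (arsinh (sin (π * h / M₁))) 0) / M₁ := by
    refine div_nonneg (sum_nonneg fun h hh => ?_) hM₁0.le
    exact cycleGreen_zero_nonneg (sin_pi_mul_div_pos hh).le
  have hlog : 1 / (2 * π) * log M₁ ≤ 1 / (2 * π) * log M₂ := by gcongr
  -- The first lower bound discards the nonnegative mode sum. The second has room to spare: the
  -- formula contains `+M₂/(12 M₁)` where the claim has a minus sign, and `M₂/M₁ ≥ 1` absorbs the
  -- `1/24`.
  refine ⟨by linarith, max_le (by linarith) (by linarith)⟩
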